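/- All rings are commutative with identity. A ring $R$ is \emph{chained} if any two of its ideals are comparable under inclusion. A \emph{multiplicative subset} $S$ of $R$ is a nonempty subset closed under multiplication; its \emph{saturation} is $\overline S=\{x\in R : xy\in S \text{ for some } y\in R\}$. For a positive integer $n$, an ideal $I$ of $R$ disjoint from $S$ is \emph{$S$-$n$-absorbing} if there is $s\in S$ such that, whenever $r_1,\dots,r_{n+1}\in R$ and $r_1\cdots r_{n+1}\in I$, we have $s\prod_{i\neq j} r_i\in I$ for some $1\le j\le n+1$. For an ideal $I$ disjoint from $S$, let $\omega_{R,S}(I)$ be the least positive integer $n$ such that $I$ is $S$-$n$-absorbing, and $\omega_{R,S}(I)=\infty$ if there is no such $n$. Let $\Omega_S(R)=\{\omega_{R,S}(I) : I \text{ is an ideal of } R \text{ disjoint from } S\}$, and let $\mathbb N$ be the set of positive integers. \textbf{Theorem.} Let $R$ be a chained ring and let $S$ be a multiplicative subset of $R$ with saturation $\overline S$. If $\Omega_S(R)\subseteq\mathbb N$, then either every nonunit regular element (that is, nonunit non-zero-divisor) of $R$ belongs to $\overline S$, or $R$ is a Noetherian ring. Consequently, if $R$ is a valuation domain (a chained ring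 that is an integral domain) and $S$ is a multiplicative subset of $R$ with $0\notin S$, then $\Omega_S(R)\subseteq\mathbb N$ if and only if either the localization $R_S$ is a field or $R$ is a Noetherian ring. -/

import Mathlib

section SAbsorbing

variable {R : Type*} [CommRing R]

/-- A chained ring: any two ideals are comparable. -/
def IsChainedRing (R : Type*) [CommRing R] : Prop :=
  ∀ I J : Ideal R, I ≤ J ∨ J ≤ I

/-- `I` is disjoint from `S` and there is one `s ∈ S` such that whenever a product of `n + 1`
elements lies in `I`, then `s` times the product of some `n` of them lies in `I`. -/
def IsSAbsorbing (S : Subsemigroup R) (n : ℕ) (I : Ideal R) : Prop :=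
  Disjoint (I : Set R) (S : Set R) ∧
    ∃ s ∈ S, ∀ r : Fin (n + 1) → R, ∏ i, r i ∈ I →
      ∃ j, s * ∏ i ∈ Finset.univ.erase j, r i ∈ I

/-- The least positive integer `n` such that `I` is `S`-`n`-absorbing, and `∞` if there is none
(the infimum of the empty set in `ℕ∞` is `⊤`). -/
noncomputable def sAbsorbingNumber (S : Subsemigroup R) (I : Ideal R) : ℕ∞ :=
  sInf ((fun n : ℕ => (n : ℕ∞)) '' {n : ℕ | 1 ≤ n ∧ IsSAbsorbing S n I})

/-- The set of the values `ω(I)`, where `I` runs over the ideals disjoint from `S`. -/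
def sAbsorbingNumbers (S : Subsemigroup R) : Set ℕ∞ :=
  {m | ∃ I : Ideal R, Disjoint (I : Set R) (S : Set R) ∧ sAbsorbingNumber S I = m}

/-- The saturation of a multiplicative subset: all divisors of its elements. -/
def multSaturation (S : Subsemigroup R) : Set R :=
  {x | ∃ y : R, x * y ∈ S}

/-- The positive integers inside `ℕ∞`. -/
def positiveIntegers : Set ℕ∞ :=
  (fun n : ℕ => (n : ℕ∞)) '' {n : ℕ | 1 ≤ n}

end SAbsorbing

section

variable {R : Type*} [CommRing R]

/-! Suppose a regular nonunit `r` divides no element of `S`. By comparability every element of `S`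
divides `r`, and absorption for `(r ^ 2)` forces `S` to consist of units
(`IsChainedRing.isUnit_of_mem`). For each nonzero nonunit, absorption then bounds the length of its
factorizations into nonunits. Hence the maximal ideal is some `(π)`, and each nonzero element is a
power of `π` times a unit, so `R` is Noetherian. For a domain, conversely: if `R_S` is a field, only
`⊥` is disjoint from `S`; if `R` is Noetherian, Krull's intersection theorem puts a power of the
maximal ideal inside every nonzero ideal. -/

theorem sAbsorbingNumbers_subset_positiveIntegers_iff {S : Subsemigroup R} :
    sAbsorbingNumbers S ⊆ positiveIntegers ↔
      ∀ I : Ideal R, Disjoint (I : Set R) (S : Set R) → ∃ n : ℕ, 1 ≤ n ∧ IsSAbsorbing S n I := by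
  constructor
  · intro h I hI
    obtain ⟨m, -, hm⟩ := h ⟨I, hI, rfl⟩
    by_contra! hne
    have hempty : {n : ℕ | 1 ≤ n ∧ IsSAbsorbing S n I} = ∅ := by
      ext n
      simpa using hne n
    rw [sAbsorbingNumber, hempty, Set.image_empty, sInf_empty] at hm
    exact ENat.natCast_ne_top m hm
  · rintro h _ ⟨I, hI, rfl⟩
    obtain ⟨n, hn⟩ := h I hI
    obtain ⟨m, hm, hmI⟩ := csInf_mem (s := (fun n : ℕ => (n : ℕ∞)) ''
      {n : ℕ | 1 ≤ n ∧ IsSAbsorbing S n I}) ⟨_, n, hn, rfl⟩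
    exact ⟨m, hm.1, hmI⟩

/-! ### Divisibility and factorizations in chained rings -/

theorem IsChainedRing.dvd_total (hR : IsChainedRing R) (a b : R) : a ∣ b ∨ b ∣ a := by
  rcases hR (Ideal.span {a}) (Ideal.span {b}) with h | h
  · exact Or.inr (Ideal.span_singleton_le_span_singleton.1 h)
  · exact Or.inl (Ideal.span_singleton_le_span_singleton.1 h)

theorem IsChainedRing.isLocalRing [Nontrivial R] (hR : IsChainedRing R) : IsLocalRing R := by
  refine IsLocalRing.of_nonunits_add fun a b ha hb hab => ?_
  rcases hR.dvd_total a b with h | h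
  · exact ha (isUnit_of_dvd_unit (dvd_add dvd_rfl h) hab)
  · exact hb (isUnit_of_dvd_unit (dvd_add h dvd_rfl) hab)

theorem disjoint_span_singleton {S : Subsemigroup R} {a : R} (ha : ∀ s ∈ S, ¬ a ∣ s) :
    Disjoint (Ideal.span {a} : Set R) (S : Set R) :=
  Set.disjoint_left.2 fun _ hx hs => ha _ hs (Ideal.mem_span_singleton.1 hx)

/-- If a principal ideal with regular generator is absorbing, then in every factorization of the
generator into `n + 1` factors, one of them divides a fixed element of `S`. -/
theorem IsSAbsorbing.exists_dvd_of_isRegular {S : Subsemigroup R} {n : ℕ} {a : R}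
    (h : IsSAbsorbing S n (Ideal.span {a})) (ha : IsRegular a) :
    ∃ s ∈ S, ∀ f : Fin (n + 1) → R, ∏ i, f i = a → ∃ j, f j ∣ s := by
  obtain ⟨-, s, hs, h⟩ := h
  refine ⟨s, hs, fun f hf => ?_⟩
  obtain ⟨j, hj⟩ := h f (hf ▸ Ideal.mem_span_singleton_self _)
  obtain ⟨t, ht⟩ := Ideal.mem_span_singleton.1 hj
  refine ⟨j, t, ha.left ?_⟩
  have hprod := Finset.mul_prod_erase Finset.univ f (Finset.mem_univ j)
  rw [hf] at hprod
  calc a * s = f j * (s * ∏ i ∈ Finset.univ.erase j, f i) := by rw [← hprod]; ring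
    _ = a * (f j * t) := by rw [ht]; ring

/-- A Nakayama argument replaces regularity: the omitted factor satisfies `a = f j * t * a`, and `1
- f j * t` is a unit when `f j` is not. -/
theorem IsSAbsorbing.exists_isUnit [IsLocalRing R] {S : Subsemigroup R}
    (hS : ∀ s ∈ S, IsUnit s) {n : ℕ} {a : R}
    (h : IsSAbsorbing S n (Ideal.span {a})) (ha : a ≠ 0) (f : Fin (n + 1) → R)
    (hf : ∏ i, f i = a) : ∃ j, IsUnit (f j) := by
  obtain ⟨-, s, hs, h⟩ := h
  obtain ⟨j, hj⟩ := h f (hf ▸ Ideal.mem_span_singleton_self _)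
  obtain ⟨t, ht⟩ := (hS s hs).dvd_mul_left.1 (Ideal.mem_span_singleton.1 hj)
  refine ⟨j, by_contra fun hu => ha ?_⟩
  have hprod := Finset.mul_prod_erase Finset.univ f (Finset.mem_univ j)
  rw [hf] at hprod
  have hunit : IsUnit (1 - f j * t) := by
    refine (IsLocalRing.isUnit_or_isUnit_one_sub_self (f j * t)).resolve_left fun h' => hu ?_
    exact isUnit_of_mul_isUnit_left h'
  refine hunit.mul_left_eq_zero.1 ?_
  rw [mul_sub, mul_one, sub_eq_zero]
  nth_rewrite 1 [← hprod]
  rw [ht]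
  ring

/-- If a regular nonunit has no multiple in `S` and all invariants are finite, then `S` consists of
units. -/
theorem IsChainedRing.isUnit_of_mem (hR : IsChainedRing R) {S : Subsemigroup R}
    (h : ∀ I : Ideal R, Disjoint (I : Set R) (S : Set R) → ∃ n : ℕ, 1 ≤ n ∧ IsSAbsorbing S n I)
    {r : R} (hr : IsRegular r) (hrS : ∀ s ∈ S, ¬ r ∣ s) {s : R} (hs : s ∈ S) : IsUnit s := by
  obtain ⟨n, hn, habs⟩ := h (Ideal.span {r ^ 2})
    (disjoint_span_singleton fun s hs hd => hrS s hs ((dvd_pow_self r two_ne_zero).trans hd))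
  obtain ⟨σ, hσ, hσf⟩ := habs.exists_dvd_of_isRegular (hr.pow 2)
  obtain ⟨m, rfl⟩ := Nat.exists_eq_add_of_le' hn
  -- The leading `σ` covers `k = 0`, since `S` need not contain `1`.
  have hpow : ∀ k : ℕ, σ * ((σ * s) ^ 2) ^ k ∈ S := by
    intro k
    induction k with
    | zero => simpa using hσ
    | succ k ih =>
      have ht := S.mul_mem hσ hs
      rw [pow_succ, ← mul_assoc]
      exact S.mul_mem ih (by rw [sq]; exact S.mul_mem ht ht)
  obtain ⟨x, hx⟩ : ((σ * s) ^ 2) ^ m ∣ r :=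
    (hR.dvd_total _ _).resolve_right fun hd => hrS _ (hpow m) (hd.mul_left _)
  obtain ⟨j, hj⟩ := hσf (Fin.cons r (Fin.cons x fun _ : Fin m => (σ * s) ^ 2)) (by
    rw [Fin.prod_univ_succ, Fin.prod_univ_succ]
    simp only [Fin.cons_zero, Fin.cons_succ, Finset.prod_const, Finset.card_univ, Fintype.card_fin]
    rw [mul_comm x, ← hx, sq])
  induction j using Fin.cases with
  | zero => exact absurd hj (hrS σ hσ)
  | succ j =>
    induction j using Fin.cases with
    | zero =>
      refine absurd ?_ (hrS _ (hpow m))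
      rw [hx, mul_comm]
      exact mul_dvd_mul_right (by simpa using hj) _
    | succ j =>
      obtain ⟨t, ht⟩ : (σ * s) ^ 2 ∣ σ := by simpa using hj
      -- As a divisor of the regular element `r`, `σ` can be cancelled.
      obtain ⟨c, hc⟩ : σ ∣ r := (hR.dvd_total _ _).resolve_right (hrS σ hσ)
      refine IsUnit.of_mul_eq_one (σ * s * t) (hr.left ?_)
      change r * _ = r * 1
      calc r * (s * (σ * s * t)) = c * ((σ * s) ^ 2 * t) := by rw [hc]; ring
        _ = r * 1 := by rw [← ht, hc]; ring

/-- If the nonunits of a chained ring do not form a principal ideal, then every nonunit is a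
product of arbitrarily many nonunits. -/
theorem IsChainedRing.exists_prod_nonunits (hR : IsChainedRing R)
    (hM : ∀ a : R, ¬ IsUnit a → ∃ b, ¬ IsUnit b ∧ ¬ a ∣ b) (n : ℕ) {a : R} (ha : ¬ IsUnit a) :
    ∃ f : Fin (n + 1) → R, (∀ i, ¬ IsUnit (f i)) ∧ ∏ i, f i = a := by
  induction n generalizing a with
  | zero => exact ⟨fun _ => a, fun _ => ha, by simp⟩
  | succ n ih =>
    obtain ⟨b, hb, hab⟩ := hM a ha
    obtain ⟨c, rfl⟩ := (hR.dvd_total a b).resolve_left hab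
    obtain ⟨f, hf, hfc⟩ := ih (a := c) fun hc => hab (hc.mul_right_dvd.2 dvd_rfl)
    refine ⟨Fin.cons b f, Fin.cases (by simpa using hb) (by simpa using hf), ?_⟩
    rw [Fin.prod_univ_succ]
    simp [hfc]

theorem isNoetherianRing_of_forall_eq_pow_mul {π : R}
    (h : ∀ a : R, a ≠ 0 → ∃ (k : ℕ) (u : R), IsUnit u ∧ a = π ^ k * u) :
    IsNoetherianRing R := by
  classical
  refine (isNoetherianRing_iff_ideal_fg R).2 fun I => ?_
  by_cases hI : I = ⊥
  · exact hI ▸ Submodule.fg_bot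
  have hpow : ∀ a ∈ I, a ≠ 0 → ∃ k, π ^ k ∈ I ∧ π ^ k ∣ a := by
    intro a ha h0
    obtain ⟨k, u, hu, rfl⟩ := h a h0
    exact ⟨k, (Ideal.mul_unit_mem_iff_mem I hu).1 ha, dvd_mul_right _ _⟩
  obtain ⟨a, ha, h0⟩ := Submodule.exists_mem_ne_zero_of_ne_bot hI
  have hex : ∃ k, π ^ k ∈ I := (hpow a ha h0).imp fun _ hk => hk.1
  refine ⟨{π ^ Nat.find hex}, le_antisymm ?_ fun b hb => ?_⟩
  · rw [Submodule.span_le]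
    simpa using Nat.find_spec hex
  · rw [Finset.coe_singleton]
    refine Ideal.mem_span_singleton.2 ?_
    rcases eq_or_ne b 0 with rfl | hb0
    · exact dvd_zero _
    · obtain ⟨k, hk, hkb⟩ := hpow b hb hb0
      exact (pow_dvd_pow π (Nat.find_min' hex hk)).trans hkb

theorem IsChainedRing.isNoetherianRing (hR : IsChainedRing R) {S : Subsemigroup R}
    (h : ∀ I : Ideal R, Disjoint (I : Set R) (S : Set R) → ∃ n : ℕ, 1 ≤ n ∧ IsSAbsorbing S n I)
    {r : R} (hr : IsRegular r) (hrS : ∀ s ∈ S, ¬ r ∣ s) (hru : ¬ IsUnit r) :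
    IsNoetherianRing R := by
  have : Nontrivial R := by
    by_contra hn
    rw [not_nontrivial_iff_subsingleton] at hn
    exact hru (isUnit_of_subsingleton r)
  have := hR.isLocalRing
  have hSu : ∀ s ∈ S, IsUnit s := fun s hs => hR.isUnit_of_mem h hr hrS hs
  have hbound : ∀ a : R, a ≠ 0 → ¬ IsUnit a → ∃ n : ℕ, 1 ≤ n ∧
      ∀ f : Fin (n + 1) → R, ∏ i, f i = a → ∃ j, IsUnit (f j) := by
    intro a h0 ha
    obtain ⟨n, hn, habs⟩ := h (Ideal.span {a})
      (disjoint_span_singleton fun s hs hd => ha (isUnit_of_dvd_unit hd (hSu s hs)))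
    exact ⟨n, hn, habs.exists_isUnit hSu h0⟩
  obtain ⟨π, hπu, hπ⟩ : ∃ π : R, ¬ IsUnit π ∧ ∀ b, ¬ IsUnit b → π ∣ b := by
    by_contra! hM
    obtain ⟨n, -, hn⟩ := hbound r hr.ne_zero hru
    obtain ⟨f, hf, hfr⟩ := hR.exists_prod_nonunits hM n hru
    obtain ⟨j, hj⟩ := hn f hfr
    exact hf j hj
  refine isNoetherianRing_of_forall_eq_pow_mul (π := π) fun a h0 => ?_
  by_cases ha : IsUnit a
  · exact ⟨0, a, ha, by simp⟩
  have hfin : FiniteMultiplicity π a := by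
    obtain ⟨n, -, hn⟩ := hbound a h0 ha
    refine ⟨n, ?_⟩
    rintro ⟨b, hb⟩
    -- Merging `b` with one `π` leaves exactly `n + 1` factors, all nonunits whatever `b` is.
    obtain ⟨j, hj⟩ := hn (Fin.cons (π * b) fun _ => π) (by
      rw [Fin.prod_univ_succ]
      simp [hb]
      ring)
    induction j using Fin.cases with
    | zero => exact hπu (isUnit_of_mul_isUnit_left (by simpa using hj))
    | succ j => exact hπu (by simpa using hj)
  obtain ⟨u, hu, hnd⟩ := hfin.exists_eq_pow_mul_and_not_dvd
  exact ⟨_, u, by_contra fun huu => hnd (hπ u huu), hu⟩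

/-! ### Ideals with finite invariant -/

theorem isSAbsorbing_one_bot [IsDomain R] {S : Subsemigroup R} (hS : (S : Set R).Nonempty)
    (h0 : (0 : R) ∉ S) : IsSAbsorbing S 1 (⊥ : Ideal R) := by
  obtain ⟨s, hs⟩ := hS
  refine ⟨Set.disjoint_left.2 ?_, s, hs, fun f hf => ?_⟩
  · rintro x hx hxS
    exact h0 ((Ideal.mem_bot.1 hx) ▸ hxS)
  · obtain ⟨i, -, hi⟩ := Finset.prod_eq_zero_iff.1 (Ideal.mem_bot.1 hf)
    obtain ⟨j, hj⟩ := exists_ne i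
    refine ⟨j, Ideal.mem_bot.2 ?_⟩
    rw [Finset.prod_eq_zero (Finset.mem_erase.2 ⟨hj.symm, Finset.mem_univ i⟩) hi, mul_zero]

/-- A unit factor can be dropped; if there is none, any `n` of the factors have product in the
`n`-th power of the maximal ideal. -/
theorem isSAbsorbing_of_maximalIdeal_pow_le [IsLocalRing R] {S : Subsemigroup R}
    (hS : (S : Set R).Nonempty) {I : Ideal R} (hI : Disjoint (I : Set R) (S : Set R)) {n : ℕ}
    (hn : IsLocalRing.maximalIdeal R ^ n ≤ I) : IsSAbsorbing S n I := by
  obtain ⟨s, hs⟩ := hS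
  refine ⟨hI, s, hs, fun f hf => ?_⟩
  by_cases hu : ∃ j, IsUnit (f j)
  · obtain ⟨j, hj⟩ := hu
    refine ⟨j, I.mul_mem_left _ ?_⟩
    rw [← Finset.mul_prod_erase Finset.univ f (Finset.mem_univ j)] at hf
    exact (Ideal.unit_mul_mem_iff_mem I hj).1 hf
  · push Not at hu
    refine ⟨0, I.mul_mem_left _ (hn ?_)⟩
    have := Ideal.prod_mem_prod (s := Finset.univ.erase (0 : Fin (n + 1)))
      (I := fun _ => IsLocalRing.maximalIdeal R) (x := f)
      fun i _ => (IsLocalRing.mem_maximalIdeal _).2 (hu i)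
    simpa using this

theorem IsChainedRing.exists_isSAbsorbing_of_isNoetherianRing [IsDomain R] [IsNoetherianRing R]
    (hR : IsChainedRing R) {S : Subsemigroup R} (hS : (S : Set R).Nonempty) (h0 : (0 : R) ∉ S)
    (I : Ideal R) (hI : Disjoint (I : Set R) (S : Set R)) :
    ∃ n : ℕ, 1 ≤ n ∧ IsSAbsorbing S n I := by
  have := hR.isLocalRing
  by_cases hbot : I = ⊥
  · exact ⟨1, le_rfl, hbot ▸ isSAbsorbing_one_bot hS h0⟩
  obtain ⟨k, hk⟩ : ∃ k, IsLocalRing.maximalIdeal R ^ k ≤ I := by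
    by_contra! hne
    refine hbot (le_bot_iff.1 ?_)
    rw [← Ideal.iInf_pow_eq_bot_of_isLocalRing (IsLocalRing.maximalIdeal R)
      (IsLocalRing.maximalIdeal.isMaximal R).ne_top]
    exact le_iInf fun k => (hR _ _).resolve_left (hne k)
  exact ⟨k + 1, by omega, isSAbsorbing_of_maximalIdeal_pow_le hS hI
    ((Ideal.pow_le_pow_right k.le_succ).trans hk)⟩

/-! ### Localization and saturation -/

theorem Subsemigroup.mem_or_eq_one_of_mem_closure {S : Subsemigroup R} {x : R}
    (hx : x ∈ Submonoid.closure (S : Set R)) : x ∈ S ∨ x = 1 := by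
  induction hx using Submonoid.closure_induction with
  | mem x hx => exact Or.inl hx
  | one => exact Or.inr rfl
  | mul x y _ _ hx hy =>
    rcases hx with hx | rfl
    · rcases hy with hy | rfl
      · exact Or.inl (S.mul_mem hx hy)
      · exact Or.inl (by simpa using hx)
    · simpa using hy

theorem isField_localization_closure_iff [IsDomain R] {S : Subsemigroup R}
    (hS : (S : Set R).Nonempty) (h0 : (0 : R) ∉ S) :
    IsField (Localization (Submonoid.closure (S : Set R))) ↔
      ∀ r : R, r ≠ 0 → r ∈ multSaturation S := by
  have hle : Submonoid.closure (S : Set R) ≤ nonZeroDivisors R := by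
    intro x hx
    refine mem_nonZeroDivisors_of_ne_zero ?_
    rcases Subsemigroup.mem_or_eq_one_of_mem_closure hx with hx | rfl
    · exact fun h => h0 (h ▸ hx)
    · exact one_ne_zero
  have hinj := IsLocalization.injective (Localization (Submonoid.closure (S : Set R))) hle
  have hdom : IsDomain (Localization (Submonoid.closure (S : Set R))) :=
    IsLocalization.isDomain_localization hle
  constructor
  · intro hF r hr
    obtain ⟨b, hb⟩ := hF.mul_inv_cancel
      ((map_ne_zero_iff (algebraMap R (Localization (Submonoid.closure (S : Set R)))) hinj).2 hr)
    obtain ⟨⟨y, m⟩, hy⟩ := IsLocalization.surj (Submonoid.closure (S : Set R)) b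
    have hry : r * y = m := by
      refine hinj ?_
      rw [map_mul, ← hy, ← mul_assoc, hb, one_mul]
    -- The denominator `m` may be `1`, outside `S`; multiplying by `s` returns to `S`.
    obtain ⟨s, hs⟩ := hS
    refine ⟨y * s, ?_⟩
    rw [← mul_assoc, hry]
    rcases Subsemigroup.mem_or_eq_one_of_mem_closure m.2 with hm | hm
    · exact S.mul_mem hm hs
    · rw [hm, one_mul]
      exact hs
  · intro h
    refine ⟨⟨0, 1, zero_ne_one⟩, mul_comm, fun {a} ha => ?_⟩
    obtain ⟨⟨x, m⟩, hx⟩ := IsLocalization.surj (Submonoid.closure (S : Set R)) a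
    have hx0 : x ≠ 0 := by
      rintro rfl
      rw [map_zero, (IsLocalization.map_units _ m).mul_left_eq_zero] at hx
      exact ha hx
    obtain ⟨y, hy⟩ := h x hx0
    have hu := IsLocalization.map_units (Localization (Submonoid.closure (S : Set R)))
      (⟨x * y, Submonoid.subset_closure hy⟩ : Submonoid.closure (S : Set R))
    rw [map_mul, ← hx, mul_assoc] at hu
    exact (isUnit_of_mul_isUnit_left hu).exists_right_inv

end

theorem mainTheorem4 {R : Type*} [CommRing R] (hR : IsChainedRing R)
    (S : Subsemigroup R) (hS : (S : Set R).Nonempty) :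
    (sAbsorbingNumbers S ⊆ positiveIntegers →
      (∀ r : R, IsRegular r → ¬ IsUnit r → r ∈ multSaturation S) ∨ IsNoetherianRing R) ∧
    (IsDomain R → (0 : R) ∉ S →
      (sAbsorbingNumbers S ⊆ positiveIntegers ↔
        IsField (Localization (Submonoid.closure (S : Set R))) ∨ IsNoetherianRing R)) := by
  have key : sAbsorbingNumbers S ⊆ positiveIntegers →
      (∀ r : R, IsRegular r → ¬ IsUnit r → r ∈ multSaturation S) ∨ IsNoetherianRing R := by
    intro h
    rw [or_iff_not_imp_left]
    intro hne
    push Not at hne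
    obtain ⟨r, hr, hru, hrS⟩ := hne
    refine hR.isNoetherianRing (sAbsorbingNumbers_subset_positiveIntegers_iff.1 h) hr ?_ hru
    rintro _ hs ⟨y, rfl⟩
    exact hrS ⟨y, hs⟩
  refine ⟨key, fun _ h0 => ⟨fun h => (key h).imp_left fun hsat => ?_, ?_⟩⟩
  · refine (isField_localization_closure_iff hS h0).2 fun r hr => ?_
    by_cases hru : IsUnit r
    · obtain ⟨y, hy⟩ := hru.exists_right_inv
      obtain ⟨s, hs⟩ := hS
      exact ⟨y * s, by rwa [← mul_assoc, hy, one_mul]⟩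
    · exact hsat r (IsRegular.of_ne_zero hr) hru
  · rw [sAbsorbingNumbers_subset_positiveIntegers_iff]
    rintro (hF | hN) I hI
    · refine ⟨1, le_rfl, ?_⟩
      suffices hbot : I = ⊥ from hbot ▸ isSAbsorbing_one_bot hS h0
      refine (Submodule.eq_bot_iff I).2 fun x hx => by_contra fun hx0 => ?_
      obtain ⟨y, hy⟩ := (isField_localization_closure_iff hS h0).1 hF x hx0
      exact Set.disjoint_left.1 hI (I.mul_mem_right y hx) hy
    · exact hR.exists_isSAbsorbing_of_isNoetherianRing hS h0 I hI
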